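/- A finite word is called a palindrome pair if it is a product $pq$ of two palindromes $p$ and $q$, where the empty word counts as a palindrome. An infinite word ${\bf w}$ has property PP if for infinitely many $n$ every length-$n$ factor of ${\bf w}$ is a palindrome pair. Let $\mu$ be the morphism given by $0\mapsto 01$, $1\mapsto 10$, and let ${\bf t}=\mu^\omega(0)$ be the Thue--Morse word, that is, the infinite word that has every $\mu^k(0)$, $k\ge 0$, as a prefix. Theorem. The Thue--Morse word ${\bf t}$ does not have property PP. More precisely, for $0\le n\le 5$ every length-$n$ factor of ${\bf t}$ is a palindrome pair, and for every $n\ge 6$ there is at least one length-$n$ factor of ${\bf t}$ that is not a palindrome pair. -/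

import Mathlib

namespace InfiniteWord

/-- The block of length `n` of the infinite word `w` that starts at position `i`. -/
def block {α : Type*} (w : ℕ → α) (i n : ℕ) : List α :=
  (List.range n).map fun j => w (i + j)

/-- The finite word `u` is a factor of the infinite word `w`. -/
def IsFactor {α : Type*} (u : List α) (w : ℕ → α) : Prop :=
  ∃ i n : ℕ, u = block w i n

/-- A palindrome pair is a product of two palindromes; the empty word is a palindrome. -/
def IsPalindromePair {α : Type*} (u : List α) : Prop :=
  ∃ p q : List α, p.Palindrome ∧ q.Palindrome ∧ u = p ++ q

/-- Property PP: for infinitely many `n`, every factor of length `n` is a palindrome pair. -/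
def PropertyPP {α : Type*} (w : ℕ → α) : Prop :=
  {n : ℕ | ∀ u : List α, IsFactor u w → u.length = n → IsPalindromePair u}.Infinite

/-- The morphism given by `0 ↦ 01`, `1 ↦ 10`, on letters. -/
def muLetter : Fin 2 → List (Fin 2)
  | 0 => [0, 1]
  | 1 => [1, 0]

/-- The morphism given by `0 ↦ 01`, `1 ↦ 10`, on finite words. -/
def mu (u : List (Fin 2)) : List (Fin 2) := u.flatMap muLetter

theorem mu_append (u v : List (Fin 2)) : mu (u ++ v) = mu u ++ mu v := by
  simp [mu]

theorem length_mu (u : List (Fin 2)) : (mu u).length = 2 * u.length := by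
  induction u with
  | nil => rfl
  | cons a u ih =>
    have h : (muLetter a).length = 2 := by fin_cases a <;> rfl
    have e : mu (a :: u) = muLetter a ++ mu u := by simp [mu]
    rw [e, List.length_append, ih, h, List.length_cons]
    ring

theorem length_mu_iterate (k : ℕ) : (mu^[k] [0]).length = 2 ^ k := by
  induction k with
  | zero => rfl
  | succ k ih => rw [Function.iterate_succ_apply', length_mu, ih, pow_succ, mul_comm]

/-- The Thue–Morse word, the infinite word that has all the iterates of `mu` on the word `0` as
prefixes (see `block_thueMorse`). Its letter at position `n` is read off the `n`-th iterate,
which has length `2 ^ n`. -/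
def thueMorse (n : ℕ) : Fin 2 :=
  (mu^[n] [0])[n]'(by rw [length_mu_iterate]; exact Nat.lt_two_pow_self)

theorem mu_iterate_prefix_succ (k : ℕ) : mu^[k] [0] <+: mu^[k + 1] [0] := by
  induction k with
  | zero => exact ⟨[1], rfl⟩
  | succ k ih =>
    obtain ⟨v, hv⟩ := ih
    refine ⟨mu v, ?_⟩
    rw [Function.iterate_succ_apply' mu k, ← mu_append, hv, ← Function.iterate_succ_apply' mu (k + 1)]

theorem mu_iterate_prefix {k l : ℕ} (h : k ≤ l) : mu^[k] [0] <+: mu^[l] [0] := by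
  induction l, h using Nat.le_induction with
  | base => exact List.prefix_rfl
  | succ l _ ih => exact ih.trans (mu_iterate_prefix_succ l)

/-- Every iterate of `mu` on the word `0` is a prefix of the Thue–Morse word. -/
theorem block_thueMorse (k : ℕ) : block thueMorse 0 (2 ^ k) = mu^[k] [0] := by
  apply List.ext_getElem
  · simp [block, length_mu_iterate]
  · intro n h1 h2
    simp only [block, List.getElem_map, List.getElem_range, Nat.zero_add, thueMorse]
    rcases le_total n k with h | h
    · exact (mu_iterate_prefix h).getElem _
    · exact ((mu_iterate_prefix h).getElem _).symm

end InfiniteWord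

namespace InfiniteWord

/-! Palindromes in the Thue–Morse word are rigid: odd ones have length at most 3, and nonempty even
ones are centred at even positions. For even n > 6 both parts of a palindrome pair are then even,
and their centres constrain the cut. If n ≡ 2 mod 4, the prefix of length n admits no cut. If n =
4r, a pair at a position divisible by 4 cuts at a multiple of 4 and desubstitutes under μ² to a pair
of length r, so induction applies. If n is odd, one part has length 1 or 3, and a suitably placed
window defeats the few cuts left. The remaining short lengths are finite checks. -/

theorem getElem?_mu_even (u : List (Fin 2)) (m : ℕ) : (mu u)[2 * m]? = u[m]? := by
  induction u generalizing m with
  | nil => simp [mu]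
  | cons a u ih =>
    have e : mu (a :: u) = [a, 1 - a] ++ mu u := by fin_cases a <;> rfl
    rw [e]
    cases m with
    | zero => simp
    | succ m => simpa [Nat.mul_succ] using ih m

theorem getElem?_mu_odd (u : List (Fin 2)) (m : ℕ) :
    (mu u)[2 * m + 1]? = u[m]?.map (1 - ·) := by
  induction u generalizing m with
  | nil => simp [mu]
  | cons a u ih =>
    have e : mu (a :: u) = [a, 1 - a] ++ mu u := by fin_cases a <;> rfl
    rw [e]
    cases m with
    | zero => simp
    | succ m => simpa [Nat.mul_succ] using ih m

theorem getElem?_block {α : Type*} (w : ℕ → α) {i n j : ℕ} (h : j < n) :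
    (block w i n)[j]? = some (w (i + j)) := by
  simp [block, h]

theorem length_block {α : Type*} (w : ℕ → α) (i n : ℕ) : (block w i n).length = n := by
  simp [block]

theorem mu_block_thueMorse (k : ℕ) :
    mu (block thueMorse 0 (2 ^ k)) = block thueMorse 0 (2 ^ (k + 1)) := by
  rw [block_thueMorse, block_thueMorse, Function.iterate_succ_apply']

theorem thueMorse_two_mul (m : ℕ) : thueMorse (2 * m) = thueMorse m := by
  have hm : m < 2 ^ m := Nat.lt_two_pow_self
  have h := getElem?_mu_even (block thueMorse 0 (2 ^ m)) m
  rw [mu_block_thueMorse, getElem?_block _ hm, getElem?_block _ (by rw [pow_succ]; omega)] at h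
  simpa using h

theorem thueMorse_two_mul_add_one (m : ℕ) : thueMorse (2 * m + 1) = 1 - thueMorse m := by
  have hm : m < 2 ^ m := Nat.lt_two_pow_self
  have h := getElem?_mu_odd (block thueMorse 0 (2 ^ m)) m
  rw [mu_block_thueMorse, getElem?_block _ hm, getElem?_block _ (by rw [pow_succ]; omega)] at h
  simpa using h

theorem thueMorse_two_mul_add_one_ne (m : ℕ) : thueMorse (2 * m + 1) ≠ thueMorse (2 * m) := by
  rw [thueMorse_two_mul, thueMorse_two_mul_add_one]
  generalize thueMorse m = a
  revert a; decide

theorem eq_of_ne_of_ne {a b c : Fin 2} (h : a ≠ b) (h' : c ≠ b) : a = c := by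
  revert a b c; decide

/-- The Thue–Morse word has no cube of a letter. -/
theorem thueMorse_not_cube (m : ℕ) (h : thueMorse m = thueMorse (m + 1))
    (h' : thueMorse (m + 1) = thueMorse (m + 2)) : False := by
  rcases Nat.even_or_odd' m with ⟨k, rfl | rfl⟩
  · exact thueMorse_two_mul_add_one_ne k h.symm
  · exact thueMorse_two_mul_add_one_ne (k + 1) h'.symm

/-- Supplies complemented prefixes arbitrarily far to the right, hence windows with room on their
left. -/
theorem thueMorse_two_pow_add {k n : ℕ} (h : n < 2 ^ k) :
    thueMorse (2 ^ k + n) = 1 - thueMorse n := by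
  induction k generalizing n with
  | zero =>
    obtain rfl : n = 0 := by simpa using h
    exact thueMorse_two_mul_add_one 0
  | succ k ih =>
    rw [pow_succ] at h
    rcases Nat.even_or_odd' n with ⟨m, rfl | rfl⟩
    · rw [show 2 ^ (k + 1) + 2 * m = 2 * (2 ^ k + m) by ring, thueMorse_two_mul,
        thueMorse_two_mul, ih (by omega)]
    · rw [show 2 ^ (k + 1) + (2 * m + 1) = 2 * (2 ^ k + m) + 1 by ring,
        thueMorse_two_mul_add_one, thueMorse_two_mul_add_one, ih (by omega)]

/-! ### Palindromes and palindrome pairs among blocks -/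

theorem block_add {α : Type*} (w : ℕ → α) (i k l : ℕ) :
    block w i (k + l) = block w i k ++ block w (i + k) l := by
  simp [block, List.range_add, Function.comp_def, Nat.add_assoc]

theorem palindrome_block_iff {α : Type*} (w : ℕ → α) (i n : ℕ) :
    (block w i n).Palindrome ↔ ∀ a b, a + b + 1 = n → w (i + a) = w (i + b) := by
  rw [List.Palindrome.iff_reverse_eq]
  constructor
  · intro h a b hab
    have e : (block w i n).reverse[a]? = (block w i n)[a]? := by rw [h]
    rw [List.getElem?_reverse (by rw [length_block]; omega), length_block,
      getElem?_block _ (by omega), getElem?_block _ (by omega)] at e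
    rw [show b = n - 1 - a by omega]
    simpa using e.symm
  · intro h
    refine List.ext_getElem (by simp) fun a h1 h2 => ?_
    rw [length_block] at h2
    simp only [block, List.getElem_reverse, List.getElem_map, List.getElem_range,
      List.length_map, List.length_range]
    exact h _ _ (by omega)

theorem isPalindromePair_block {α : Type*} {w : ℕ → α} {i n : ℕ}
    (h : IsPalindromePair (block w i n)) :
    ∃ k l, k + l = n ∧ (block w i k).Palindrome ∧ (block w (i + k) l).Palindrome := by
  obtain ⟨p, q, hp, hq, e⟩ := h
  have hn : p.length + q.length = n := by
    rw [← List.length_append, ← e, length_block]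
  rw [← hn, block_add] at e
  obtain ⟨h1, h2⟩ := List.append_inj e (length_block _ _ _)
  exact ⟨_, _, hn, h1.symm ▸ hp, h2.symm ▸ hq⟩

/-- The bounded cut position makes the property decidable, for the finite checks. -/
theorem isPalindromePair_iff {α : Type*} (u : List α) :
    IsPalindromePair u ↔ ∃ k < u.length + 1,
      (u.take k).reverse = u.take k ∧ (u.drop k).reverse = u.drop k := by
  constructor
  · rintro ⟨p, q, hp, hq, rfl⟩
    exact ⟨p.length, by simp, by simp [hp.reverse_eq], by simp [hq.reverse_eq]⟩
  · rintro ⟨k, -, h1, h2⟩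
    exact ⟨_, _, .of_reverse_eq h1, .of_reverse_eq h2, (List.take_append_drop k u).symm⟩

/-! ### Palindromes in the Thue–Morse word -/

/-- Odd palindromes in the Thue–Morse word have length at most `3`. -/
theorem odd_palindrome_thueMorse {i k : ℕ}
    (h : (block thueMorse i (2 * k + 1)).Palindrome) : k ≤ 1 := by
  rw [palindrome_block_iff] at h
  by_contra! hk
  have h1 := h (k - 1) (k + 1) (by omega)
  have h2 := h (k - 2) (k + 2) (by omega)
  obtain ⟨m, hm⟩ : ∃ m, i + k = m + 2 := ⟨i + k - 2, by omega⟩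
  rw [show i + (k - 1) = m + 1 by omega, show i + (k + 1) = m + 3 by omega] at h1
  rw [show i + (k - 2) = m by omega, show i + (k + 2) = m + 4 by omega] at h2
  -- The central five letters form a palindrome. For either parity of `m`, three letters at
  -- alternate positions agree, which desubstitutes to a cube of a letter.
  rcases Nat.even_or_odd' m with ⟨r, rfl | rfl⟩
  · have n0 := thueMorse_two_mul_add_one_ne r
    have n1 := thueMorse_two_mul_add_one_ne (r + 1)
    have e1 : thueMorse (2 * r) = thueMorse (2 * r + 2) :=
      eq_of_ne_of_ne n0.symm (by rw [h1]; exact n1.symm)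
    refine thueMorse_not_cube r ?_ ?_
    · rw [← thueMorse_two_mul r, ← thueMorse_two_mul (r + 1)]; exact e1
    · rw [← thueMorse_two_mul (r + 1), ← thueMorse_two_mul (r + 2)]; exact e1.symm.trans h2
  · have n1 := thueMorse_two_mul_add_one_ne (r + 1)
    have n2 := thueMorse_two_mul_add_one_ne (r + 2)
    have e1 : thueMorse (2 * r + 3) = thueMorse (2 * r + 5) :=
      eq_of_ne_of_ne n1 (by rw [show 2 * (r + 1) = 2 * r + 1 + 1 by ring, h1]; exact n2)
    have c (s : ℕ) : thueMorse (2 * s + 1) = thueMorse (2 * (s + 1) + 1) →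
        thueMorse s = thueMorse (s + 1) := by
      rw [thueMorse_two_mul_add_one, thueMorse_two_mul_add_one]
      exact fun h => sub_right_injective h
    exact thueMorse_not_cube r (c r (h2.trans e1.symm)) (c (r + 1) e1)

/-- Nonempty even palindromes in the Thue–Morse word have their centre at an even position. -/
theorem even_palindrome_thueMorse {i k : ℕ} (hk : 0 < k)
    (h : (block thueMorse i (2 * k)).Palindrome) : Even (i + k) := by
  rw [palindrome_block_iff] at h
  by_contra ho
  obtain ⟨m, hm⟩ := Nat.not_even_iff_odd.1 ho
  -- The two central letters agree, so they cannot form the image of a single letter.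
  have h1 := h (k - 1) k (by omega)
  rw [hm, show i + (k - 1) = 2 * m by omega] at h1
  exact thueMorse_two_mul_add_one_ne m h1.symm

theorem thueMorse_four_mul (m : ℕ) : thueMorse (4 * m) = thueMorse m := by
  rw [show 4 * m = 2 * (2 * m) by ring, thueMorse_two_mul, thueMorse_two_mul]

/-- Desubstitution of palindromes under the square of the morphism. -/
theorem palindrome_block_of_four_mul {i k : ℕ}
    (h : (block thueMorse (4 * i) (4 * k)).Palindrome) : (block thueMorse i k).Palindrome := by
  rw [palindrome_block_iff] at h ⊢
  intro a b hab
  -- The image of a letter under μ² begins and ends with that letter.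
  have h1 := h (4 * a) (4 * b + 3) (by omega)
  rwa [show 4 * i + 4 * a = 4 * (i + a) by ring,
    show 4 * i + (4 * b + 3) = 2 * (2 * (i + b) + 1) + 1 by ring, thueMorse_four_mul,
    thueMorse_two_mul_add_one, thueMorse_two_mul_add_one, sub_sub_cancel] at h1

/-! ### Non-pairs of each length -/

theorem isPalindromePair_of_four_mul {i n : ℕ} (hn : 2 ≤ n)
    (h : IsPalindromePair (block thueMorse (4 * i) (4 * n))) :
    IsPalindromePair (block thueMorse i n) := by
  obtain ⟨k, l, hkl, hp, hq⟩ := isPalindromePair_block h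
  have h4 : ∃ r, k = 4 * r := by
    rcases Nat.even_or_odd' k with ⟨r, rfl | rfl⟩
    · rcases Nat.eq_zero_or_pos r with rfl | hr
      · exact ⟨0, rfl⟩
      · obtain ⟨s, hs⟩ := even_palindrome_thueMorse hr hp
        exact ⟨s - 2 * i, by omega⟩
    -- Two odd palindromes have total length at most 6, less than `4 * n`.
    · obtain ⟨s, rfl⟩ : ∃ s, l = 2 * s + 1 := ⟨l / 2, by omega⟩
      have := odd_palindrome_thueMorse hp
      have := odd_palindrome_thueMorse hq
      omega
  obtain ⟨r, rfl⟩ := h4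
  obtain ⟨s, rfl⟩ : ∃ s, l = 4 * s := ⟨n - r, by omega⟩
  obtain rfl : r + s = n := by omega
  rw [← mul_add] at hq
  exact ⟨_, _, palindrome_block_of_four_mul hp, palindrome_block_of_four_mul hq,
    block_add _ _ _ _⟩

/-- From position 0, even centres force both even parts to have length divisible by 4; two odd parts
are too short. -/
theorem not_isPalindromePair_of_mod_four {n : ℕ} (hn : 7 ≤ n) (h4 : n % 4 = 2) :
    ¬ IsPalindromePair (block thueMorse 0 n) := by
  intro h
  obtain ⟨k, l, hkl, hp, hq⟩ := isPalindromePair_block h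
  rcases Nat.even_or_odd' k with ⟨r, rfl | rfl⟩
  · obtain ⟨s, rfl⟩ : ∃ s, l = 2 * s := ⟨l / 2, by omega⟩
    rcases Nat.eq_zero_or_pos r with rfl | hr
    · obtain ⟨x, hx⟩ := even_palindrome_thueMorse (by omega) hq
      omega
    · obtain ⟨x, hx⟩ := even_palindrome_thueMorse hr hp
      rcases Nat.eq_zero_or_pos s with rfl | hs
      · omega
      · obtain ⟨y, hy⟩ := even_palindrome_thueMorse hs hq
        omega
  · obtain ⟨s, rfl⟩ : ∃ s, l = 2 * s + 1 := ⟨l / 2, by omega⟩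
    have := odd_palindrome_thueMorse hp
    have := odd_palindrome_thueMorse hq
    omega

theorem block_zero_thueMorse_64 : block thueMorse 0 64 = mu^[6] [0] := block_thueMorse 6

theorem block_thueMorse_eq {i n : ℕ} (h : i + n ≤ 64) :
    block thueMorse i n = ((mu^[6] [0]).drop i).take n := by
  obtain ⟨m, hm⟩ := Nat.exists_eq_add_of_le h
  rw [← block_zero_thueMorse_64, hm, block_add, block_add, Nat.zero_add, List.append_assoc,
    List.drop_left' (length_block _ _ _), List.take_left' (length_block _ _ _)]

theorem not_isPalindromePair_of_odd {r : ℕ} (hr : 3 ≤ r) :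
    ∃ i, ¬ IsPalindromePair (block thueMorse i (2 * r + 3)) := by
  obtain ⟨N, hN, hN32, hNr⟩ : ∃ N, (∀ m < 32, thueMorse (2 * N + m) = 1 - thueMorse m) ∧
      32 ≤ 2 * N ∧ r ≤ N := by
    refine ⟨2 ^ (r + 4), fun m hm => ?_, ?_, ?_⟩
    · rw [← pow_succ']
      exact thueMorse_two_pow_add (hm.trans_le (Nat.pow_le_pow_right two_pos (by omega : 5 ≤ _)))
    · have := Nat.pow_le_pow_right two_pos (by omega : 4 ≤ r + 4)
      omega
    · exact (Nat.lt_two_pow_self.le).trans (Nat.pow_le_pow_right two_pos (by omega))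
  have val (m : ℕ) (hm : m < 64) : some (thueMorse m) = (mu^[6] [0])[m]? := by
    rw [← block_zero_thueMorse_64, getElem?_block _ hm, Nat.zero_add]
  have v19 : thueMorse 19 = 1 := Option.some_injective _ ((val 19 (by norm_num)).trans (by decide))
  have v20 : thueMorse 20 = 0 := Option.some_injective _ ((val 20 (by norm_num)).trans (by decide))
  have v24 : thueMorse 24 = 0 := Option.some_injective _ ((val 24 (by norm_num)).trans (by decide))
  have w19 := hN 19 (by norm_num)
  have w20 := hN 20 (by norm_num)
  have w24 := hN 24 (by norm_num)
  rw [v19] at w19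
  rw [v20] at w20
  rw [v24] at w24
  -- With this start, the parity of the centre leaves two cuts: an even part centred at `2 * N + 20`
  -- followed by length 3, or length 1 followed by an even part centred at `2 * N + 22`. The letters
  -- at offsets 19, 20 and at 19, 24 refute them.
  refine ⟨2 * N + 20 - r, fun h => ?_⟩
  obtain ⟨k, l, hkl, hp, hq⟩ := isPalindromePair_block h
  rcases Nat.even_or_odd' k with ⟨x, rfl | rfl⟩
  · obtain ⟨y, rfl⟩ : ∃ y, l = 2 * y + 1 := ⟨l / 2, by omega⟩
    have hy := odd_palindrome_thueMorse hq
    obtain ⟨z, hz⟩ := even_palindrome_thueMorse (by omega) hp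
    obtain rfl : y = 1 := by omega
    obtain rfl : x = r := by omega
    have e := (palindrome_block_iff _ _ _).1 hp (x - 1) x (by omega)
    rw [show 2 * N + 20 - x + (x - 1) = 2 * N + 19 by omega,
      show 2 * N + 20 - x + x = 2 * N + 20 by omega, w19, w20] at e
    exact absurd e (by decide)
  · obtain ⟨y, rfl⟩ : ∃ y, l = 2 * y := ⟨l / 2, by omega⟩
    have hx := odd_palindrome_thueMorse hp
    obtain ⟨z, hz⟩ := even_palindrome_thueMorse (by omega) hq
    obtain rfl : x = 0 := by omega
    obtain rfl : y = r + 1 := by omega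
    have e := (palindrome_block_iff _ _ _).1 hq (r - 2) (r + 3) (by omega)
    rw [show 2 * N + 20 - r + (2 * 0 + 1) + (r - 2) = 2 * N + 19 by omega,
      show 2 * N + 20 - r + (2 * 0 + 1) + (r + 3) = 2 * N + 24 by omega, w19, w24] at e
    exact absurd e (by decide)

theorem exists_not_isPalindromePair_small {n : ℕ}
    (h : n ∈ [6, 7, 8, 12, 16, 20]) : ∃ i, ¬ IsPalindromePair (block thueMorse i n) := by
  -- The general arguments miss 6 = 3 + 3, the odd length 7, and the multiples of 4 whose quarter is
  -- below 6.
  have key : ∀ n ∈ [6, 7, 8, 12, 16, 20], ∃ i < 40, i + n ≤ 64 ∧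
      ¬ ∃ k < (((mu^[6] [0]).drop i).take n).length + 1,
        ((((mu^[6] [0]).drop i).take n).take k).reverse =
          (((mu^[6] [0]).drop i).take n).take k ∧
        ((((mu^[6] [0]).drop i).take n).drop k).reverse =
          (((mu^[6] [0]).drop i).take n).drop k := by
    decide +kernel
  obtain ⟨i, -, hi, hk⟩ := key n h
  exact ⟨i, by rwa [block_thueMorse_eq hi, isPalindromePair_iff]⟩

theorem exists_not_isPalindromePair {n : ℕ} (hn : 6 ≤ n) :
    ∃ i, ¬ IsPalindromePair (block thueMorse i n) := by
  induction n using Nat.strong_induction_on with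
  | _ n ih =>
    by_cases hs : n ∈ [6, 7, 8, 12, 16, 20]
    · exact exists_not_isPalindromePair_small hs
    simp only [List.mem_cons, List.not_mem_nil, or_false, not_or] at hs
    rcases Nat.even_or_odd' n with ⟨m, rfl | rfl⟩
    · rcases Nat.even_or_odd' m with ⟨r, rfl | rfl⟩
      · obtain ⟨i, hi⟩ := ih r (by omega) (by omega)
        refine ⟨4 * i, fun h => hi (isPalindromePair_of_four_mul (by omega) ?_)⟩
        rwa [show 4 * r = 2 * (2 * r) by ring]
      · exact ⟨0, not_isPalindromePair_of_mod_four (by omega) (by omega)⟩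
    · obtain ⟨r, rfl⟩ : ∃ r, m = r + 1 := ⟨m - 1, by omega⟩
      exact not_isPalindromePair_of_odd (r := r) (by omega)

/-- Every binary word of length at most `5` is a palindrome pair. -/
theorem isPalindromePair_of_length_le_five {u : List (Fin 2)} (h : u.length ≤ 5) :
    IsPalindromePair u := by
  -- Exhaustion over all binary words, not only factors.
  have key : ∀ n < 6, ∀ f : Fin n → Fin 2, ∃ k < (List.ofFn f).length + 1,
      ((List.ofFn f).take k).reverse = (List.ofFn f).take k ∧
      ((List.ofFn f).drop k).reverse = (List.ofFn f).drop k := by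
    decide +kernel
  rw [isPalindromePair_iff]
  simpa only [List.ofFn_get] using key u.length (by omega) u.get

end InfiniteWord

theorem mainTheorem3 :
    ¬ InfiniteWord.PropertyPP InfiniteWord.thueMorse ∧
    (∀ n : ℕ, n ≤ 5 →
      ∀ u : List (Fin 2), InfiniteWord.IsFactor u InfiniteWord.thueMorse → u.length = n →
        InfiniteWord.IsPalindromePair u) ∧
    (∀ n : ℕ, 6 ≤ n →
      ∃ u : List (Fin 2), InfiniteWord.IsFactor u InfiniteWord.thueMorse ∧ u.length = n ∧
        ¬ InfiniteWord.IsPalindromePair u) := by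
  have main : ∀ n : ℕ, 6 ≤ n →
      ∃ u : List (Fin 2), InfiniteWord.IsFactor u InfiniteWord.thueMorse ∧ u.length = n ∧
        ¬ InfiniteWord.IsPalindromePair u := fun n hn =>
    let ⟨i, hi⟩ := InfiniteWord.exists_not_isPalindromePair hn
    ⟨_, ⟨i, n, rfl⟩, InfiniteWord.length_block _ _ _, hi⟩
  refine ⟨fun h => ?_, fun n hn u _ hu =>
    InfiniteWord.isPalindromePair_of_length_le_five (hu.trans_le hn), main⟩
  obtain ⟨n, hn, hn6⟩ := h.exists_gt 5
  obtain ⟨u, hf, hl, hu⟩ := main n hn6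
  exact hu (hn u hf hl)
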